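/- Let $F$ be an arbitrary field and let $L$ be a finite-dimensional (left) Leibniz algebra over $F$, i.e. a finite-dimensional $F$-vector space with a bilinear multiplication satisfying $a(bc)=(ab)c+b(ac)$ for all $a,b,c\in L$. Call a finite-dimensional Leibniz algebra $M$ over $F$ solvable if its derived series $M^{(0)}=M$, $M^{(k+1)}=M^{(k)}M^{(k)}$ (the linear span of all products of two elements of $M^{(k)}$) reaches $0$, and supersolvable if there is a chain $0=M_0\subset M_1\subset\dots\subset M_n=M$ in which each $M_i$ is an $i$-dimensional two-sided ideal of $M$. Suppose that $L$ is solvable and minimally non-supersolvable, i.e. $L$ is not supersolvable but every proper subalgebra of $L$ is supersolvable. Then $L$ is two-generated: there are $x,y\in L$ such that $L$ is the smallest subalgebra of $L$ containing $x$ and $y$. -/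

import Mathlib

/-- The (left) Leibniz identity `a(bc) = (ab)c + b(ac)`. A Leibniz algebra over a field `F` is a
(not necessarily associative, not necessarily unital) `F`-algebra satisfying it. -/
class IsLeibniz (L : Type*) [NonUnitalNonAssocRing L] : Prop where
  leibniz : ∀ a b c : L, a * (b * c) = (a * b) * c + b * (a * c)

namespace LeibnizAlg

section

variable (F : Type*) (L : Type*) [Field F] [NonUnitalNonAssocRing L] [Module F L]

/-- The derived series `L^(0) = L`, `L^(n+1) = L^(n) L^(n)`, where the product of two subspaces
is the span of the products of their elements. -/
def derivedSeries : ℕ → Submodule F L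
  | 0 => ⊤
  | n + 1 => Submodule.span F
      {z | ∃ x ∈ derivedSeries n, ∃ y ∈ derivedSeries n, x * y = z}

/-- `L` is solvable: its derived series reaches `0`. -/
def IsSolvable : Prop :=
  ∃ n : ℕ, derivedSeries F L n = ⊥

variable {F L} in
/-- A subspace is a (two-sided) ideal of `L`. -/
def IsIdeal (I : Submodule F L) : Prop :=
  ∀ x : L, ∀ y ∈ I, x * y ∈ I ∧ y * x ∈ I

/-- `L` is supersolvable: there is a chain `0 = L_0 ⊂ L_1 ⊂ ⋯ ⊂ L_n = L` where `L_i` is an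
`i`-dimensional ideal of `L`. -/
def IsSupersolvable : Prop :=
  ∃ (n : ℕ) (c : Fin (n + 1) → Submodule F L),
    StrictMono c ∧ c 0 = ⊥ ∧ c (Fin.last n) = ⊤ ∧
      ∀ i, IsIdeal (c i) ∧ Module.finrank F (c i) = (i : ℕ)

/-- `L` is minimally non-supersolvable: `L` is not supersolvable, but every proper subalgebra
of `L` is supersolvable. -/
def IsMinimallyNonSupersolvable [IsScalarTower F L L] [SMulCommClass F L L] : Prop :=
  ¬ IsSupersolvable F L ∧
    ∀ S : NonUnitalSubalgebra F L, S ≠ ⊤ → IsSupersolvable F S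

/-- `L` is two-generated: some two elements generate `L` as an algebra. -/
def IsTwoGenerated [IsScalarTower F L L] [SMulCommClass F L L] : Prop :=
  ∃ x y : L, NonUnitalAlgebra.adjoin F ({x, y} : Set L) = ⊤

end

end LeibnizAlg

/-! Suppose L is not two-generated. As L is not supersolvable, some L/I has no one-dimensional
ideal; a minimal ideal A/I of it is abelian by solvability (`exists_isNonlinearChiefFactor`). Proper
subalgebras, being supersolvable, supply stable lines, and a contradiction arises whenever such a
line is stable under all of L modulo I.

Some x, y generate L modulo A (`exists_supIdeal_adjoin_eq_top`): otherwise products act nilpotently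
on A/I, which forces an L-stable line there.

No lift x + a, y + b generates L, so every lift generates a complement of A modulo I. A rigidity
argument of the kind "first cohomology vanishes" gives (a, b) ≡ (xc, yc) for some c in A, or (a, b)
≡ 0 (`exists_conjugating_of_adjoin_ne_top`). But c has only dim A/I degrees of freedom and (a, b)
has twice as many (`not_forall_exists_conjugating`). -/

namespace LeibnizAlg

section

variable {F L : Type*} [Field F] [NonUnitalNonAssocRing L] [Module F L]

/-! ### Stable lines and supersolvability -/

/-- The elements that span, modulo `I`, a line stable under both multiplications by `s`. -/
def IsEigenMod (I : Submodule F L) (s z : L) : Prop :=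
  (∃ α : F, s * z - α • z ∈ I) ∧ ∃ α : F, z * s - α • z ∈ I

theorem exists_smul_sub_mem_of_finrank_succ [FiniteDimensional F L] {U V : Submodule F L}
    (hUV : U ≤ V) (hd : Module.finrank F V = Module.finrank F U + 1) {z : L} (hz : z ∈ V)
    (hzU : z ∉ U) {v : L} (hv : v ∈ V) : ∃ α : F, v - α • z ∈ U := by
  have hlt : U < U ⊔ F ∙ z := by
    refine lt_of_le_of_ne le_sup_left fun h => hzU ?_
    rw [h]
    exact Submodule.mem_sup_right (Submodule.mem_span_singleton_self z)
  have hle : U ⊔ F ∙ z ≤ V := sup_le hUV (by simpa using hz)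
  have heq : U ⊔ F ∙ z = V := by
    refine Submodule.eq_of_le_of_finrank_le hle ?_
    have := Submodule.finrank_lt_finrank_of_lt hlt
    omega
  rw [← heq] at hv
  obtain ⟨u, hu, w, hw, rfl⟩ := Submodule.mem_sup.1 hv
  obtain ⟨α, rfl⟩ := Submodule.mem_span_singleton.1 hw
  exact ⟨α, by simpa using hu⟩

/-- A supersolvable algebra has a stable line in every nonzero section `A / I`. -/
theorem IsSupersolvable.exists_isEigenMod [FiniteDimensional F L] (h : IsSupersolvable F L)
    {I A : Submodule F L} (hA : IsIdeal A) (hAI : ¬ A ≤ I) :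
    ∃ z ∈ A, z ∉ I ∧ ∀ s, IsEigenMod I s z := by
  obtain ⟨n, c, hc, h0, hn, hi⟩ := h
  -- The first flag member whose intersection with A escapes I gains only one dimension over its
  -- predecessor, so modulo I that intersection is a line.
  have hex : ∃ i : ℕ, ∃ hi : i < n + 1, ¬ c ⟨i, hi⟩ ⊓ A ≤ I := by
    refine ⟨n, n.lt_succ_self, ?_⟩
    change ¬ c (Fin.last n) ⊓ A ≤ I
    rwa [hn, top_inf_eq]
  classical
  obtain ⟨hlt, hsp⟩ := Nat.find_spec hex
  have hmin := fun {m : ℕ} => Nat.find_min hex (m := m)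
  generalize Nat.find hex = k at *
  obtain _ | k := k
  · refine absurd ?_ hsp
    change c 0 ⊓ A ≤ I
    simp [h0]
  have hk : c ⟨k, by omega⟩ ⊓ A ≤ I := by
    by_contra hcon
    exact hmin k.lt_succ_self ⟨_, hcon⟩
  obtain ⟨z, ⟨hz, hzA⟩, hzI⟩ := SetLike.not_le_iff_exists.1 hsp
  have key : ∀ v ∈ c ⟨k + 1, hlt⟩, v ∈ A → ∃ α : F, v - α • z ∈ I := by
    intro v hv hvA
    obtain ⟨α, hα⟩ := exists_smul_sub_mem_of_finrank_succ (U := c ⟨k, by omega⟩)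
      (hc.monotone (by simp)) (by rw [(hi _).2, (hi _).2]) hz
      (fun h => hzI (hk ⟨h, hzA⟩)) hv
    exact ⟨α, hk ⟨hα, A.sub_mem hvA (A.smul_mem _ hzA)⟩⟩
  exact ⟨z, hzA, hzI, fun s =>
    ⟨key _ ((hi _).1 s z hz).1 (hA s z hzA).1, key _ ((hi _).1 s z hz).2 (hA s z hzA).2⟩⟩

/-- Otherwise stable lines could be adjoined one at a time, starting from 0, and would build a full
flag of ideals. -/
theorem exists_maximal_line_free_ideal [IsScalarTower F L L] [SMulCommClass F L L]
    [FiniteDimensional F L] (h : ¬ IsSupersolvable F L) :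
    ∃ I : Submodule F L, IsIdeal I ∧ I ≠ ⊤ ∧ ∀ z, (∀ s, IsEigenMod I s z) → z ∈ I := by
  by_contra! hcon
  apply h
  have hstep : ∀ I : Submodule F L, ∃ J : Submodule F L, IsIdeal I → I ≠ ⊤ →
      IsIdeal J ∧ I < J ∧ Module.finrank F J = Module.finrank F I + 1 := by
    intro I
    by_cases hI : IsIdeal I
    swap
    · exact ⟨I, fun h => absurd h hI⟩
    by_cases hT : I = ⊤
    · exact ⟨I, fun _ h => absurd hT h⟩
    obtain ⟨z, hz, hzI⟩ := hcon I hI hT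
    refine ⟨I ⊔ F ∙ z, fun _ _ => ⟨?_, ?_, ?_⟩⟩
    · intro x y hy
      obtain ⟨u, hu, w, hw, rfl⟩ := Submodule.mem_sup.1 hy
      obtain ⟨β, rfl⟩ := Submodule.mem_span_singleton.1 hw
      have hzz : z ∈ I ⊔ F ∙ z :=
        Submodule.mem_sup_right (Submodule.mem_span_singleton_self z)
      have aux : ∀ v : L, (∃ α : F, v - α • z ∈ I) → v ∈ I ⊔ F ∙ z := by
        rintro v ⟨α, hα⟩
        simpa using add_mem (Submodule.mem_sup_left (T := F ∙ z) hα)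
          (Submodule.smul_mem _ α hzz)
      rw [mul_add, add_mul, mul_smul_comm, smul_mul_assoc]
      exact ⟨add_mem (Submodule.mem_sup_left (hI x u hu).1)
          (Submodule.smul_mem _ _ (aux _ (hz x).1)),
        add_mem (Submodule.mem_sup_left (hI x u hu).2)
          (Submodule.smul_mem _ _ (aux _ (hz x).2))⟩
    · refine lt_of_le_of_ne le_sup_left fun h => hzI ?_
      rw [h]
      exact Submodule.mem_sup_right (Submodule.mem_span_singleton_self z)
    · have hz0 : z ≠ 0 := fun h => hzI (h ▸ I.zero_mem)
      have h1 := Submodule.finrank_sup_add_finrank_inf_eq I (F ∙ z)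
      rw [finrank_span_singleton hz0, ((Submodule.disjoint_span_singleton' hz0).2 hzI).eq_bot,
        finrank_bot] at h1
      simpa using h1
  choose f hf using hstep
  set c : ℕ → Submodule F L := fun n => f^[n] ⊥ with hc
  have hsucc : ∀ n, c (n + 1) = f (c n) := fun n => Function.iterate_succ_apply' f n ⊥
  have hprop : ∀ n ≤ Module.finrank F L, IsIdeal (c n) ∧ Module.finrank F (c n) = n := by
    intro n
    induction n with
    | zero =>
      intro _
      refine ⟨?_, by simp [hc]⟩
      rintro x y hy
      have hy0 : y = 0 := by simpa [hc] using hy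
      simp [hy0]
    | succ n ih =>
      intro hn
      obtain ⟨h1, h2⟩ := ih (by omega)
      have := hf (c n) h1 (fun h => by rw [h, finrank_top] at h2; omega)
      rw [hsucc]
      exact ⟨this.1, by rw [this.2.2, h2]⟩
  refine ⟨Module.finrank F L, fun i => c i, ?_, rfl, ?_, fun i => hprop i (by omega)⟩
  · refine Fin.strictMono_iff_lt_succ.2 fun i => ?_
    have hi := hprop i (by omega)
    simp only [Fin.val_castSucc, Fin.val_succ, hsucc]
    exact (hf _ hi.1 (fun h => by have := hi.2; rw [h, finrank_top] at this; omega)).2.1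
  · exact Submodule.eq_top_of_finrank_eq (hprop _ le_rfl).2

/-! ### Solvability, and sums of subalgebras with ideals -/

/-- Iterating the inclusion B ≤ BB + J pushes B into every derived term plus J. -/
theorem le_of_le_span_mul_sup [IsScalarTower F L L] [SMulCommClass F L L]
    (hsolv : IsSolvable F L) {B J : Submodule F L}
    (hJ : IsIdeal J) (h : B ≤ Submodule.span F {z | ∃ x ∈ B, ∃ y ∈ B, x * y = z} ⊔ J) :
    B ≤ J := by
  have key : ∀ n, B ≤ derivedSeries F L n ⊔ J := by
    intro n
    induction n with
    | zero => simp [derivedSeries]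
    | succ n ih =>
      refine h.trans (sup_le (Submodule.span_le.2 ?_) le_sup_right)
      rintro _ ⟨x, hx, y, hy, rfl⟩
      obtain ⟨d, hd, j, hj, rfl⟩ := Submodule.mem_sup.1 (ih hx)
      obtain ⟨e, he, k, hk, rfl⟩ := Submodule.mem_sup.1 (ih hy)
      refine Submodule.mem_sup.2 ⟨d * e, Submodule.subset_span ⟨d, hd, e, he, rfl⟩,
        d * k + j * (e + k), add_mem (hJ _ _ hk).1 (hJ _ _ hj).2, ?_⟩
      simp only [mul_add, add_mul]
      abel
  obtain ⟨n, hn⟩ := hsolv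
  simpa [hn] using key n

/-- The sum of a subalgebra and an ideal. -/
def supIdeal (S : NonUnitalSubalgebra F L) (A : Submodule F L) (hA : IsIdeal A) :
    NonUnitalSubalgebra F L :=
  { S.toSubmodule ⊔ A with
    mul_mem' := by
      intro x y hx hy
      obtain ⟨s, hs, a, ha, rfl⟩ := Submodule.mem_sup.1 hx
      obtain ⟨t, ht, b, hb, rfl⟩ := Submodule.mem_sup.1 hy
      refine Submodule.mem_sup.2 ⟨s * t, S.mul_mem hs ht, s * b + a * (t + b),
        add_mem (hA _ _ hb).1 (hA _ _ ha).2, ?_⟩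
      simp only [mul_add, add_mul]
      abel }

theorem mem_supIdeal {S : NonUnitalSubalgebra F L} {A : Submodule F L} {hA : IsIdeal A} {v : L} :
    v ∈ supIdeal S A hA ↔ ∃ s ∈ S, ∃ a ∈ A, s + a = v :=
  Submodule.mem_sup

theorem le_supIdeal (S : NonUnitalSubalgebra F L) (A : Submodule F L) (hA : IsIdeal A) :
    S ≤ supIdeal S A hA :=
  fun s hs => mem_supIdeal.2 ⟨s, hs, 0, A.zero_mem, add_zero s⟩

theorem mem_supIdeal_of_mem (S : NonUnitalSubalgebra F L) {A : Submodule F L} (hA : IsIdeal A)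
    {a : L} (ha : a ∈ A) : a ∈ supIdeal S A hA :=
  mem_supIdeal.2 ⟨0, S.zero_mem, a, ha, zero_add a⟩

theorem exists_isEigenMod_of_subalgebra [FiniteDimensional F L] {S : NonUnitalSubalgebra F L}
    (hS : IsSupersolvable F S) {I A : Submodule F L} (hA : IsIdeal A)
    {w : L} (hwS : w ∈ S) (hwA : w ∈ A) (hwI : w ∉ I) :
    ∃ z ∈ S, z ∈ A ∧ z ∉ I ∧ ∀ s ∈ S, IsEigenMod I s z := by
  have : FiniteDimensional F S := inferInstanceAs (FiniteDimensional F S.toSubmodule)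
  let ι : S →ₗ[F] L := ⟨⟨Subtype.val, fun _ _ => rfl⟩, fun _ _ => rfl⟩
  have hA' : IsIdeal (A.comap ι) := fun x y hy => ⟨(hA x y hy).1, (hA x y hy).2⟩
  obtain ⟨z, hz, hzI, h⟩ := hS.exists_isEigenMod
    (I := I.comap ι) hA' (fun hle => hwI (hle (x := ⟨w, hwS⟩) hwA))
  exact ⟨z, z.2, hz, hzI, fun s hs => ⟨(h ⟨s, hs⟩).1, (h ⟨s, hs⟩).2⟩⟩

/-! ### Nilpotent action of products -/

instance isLeibniz_subalgebra [IsLeibniz L] (S : NonUnitalSubalgebra F L) : IsLeibniz S :=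
  ⟨fun a b c => Subtype.ext (IsLeibniz.leibniz (a : L) b c)⟩

theorem mul_mul_left [IsLeibniz L] (a b c : L) : (a * b) * c = a * (b * c) - b * (a * c) := by
  rw [IsLeibniz.leibniz a b c]
  abel

/-- In a supersolvable Leibniz algebra, left multiplication by a product is nilpotent. -/
theorem IsSupersolvable.exists_iterate_mul_eq_zero [SMulCommClass F L L]
    [IsLeibniz L] [FiniteDimensional F L]
    (h : IsSupersolvable F L) (k l : L) : ∃ n : ℕ, ∀ v : L, (fun w => k * l * w)^[n] v = 0 := by
  obtain ⟨n, c, hc, h0, hn, hi⟩ := h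
  have key : ∀ (m : ℕ) (hm : m < n + 1), ∀ v ∈ c ⟨m, hm⟩, (fun w => k * l * w)^[m] v = 0 := by
    intro m
    induction m with
    | zero =>
      intro hm v hv
      change v ∈ c 0 at hv
      simpa [h0] using hv
    | succ m ih =>
      intro hm v hv
      rw [Function.iterate_succ_apply]
      refine ih (by omega) _ ?_
      have hle : c ⟨m, by omega⟩ ≤ c ⟨m + 1, hm⟩ := hc.monotone (by simp)
      have hd : Module.finrank F (c ⟨m + 1, hm⟩) = Module.finrank F (c ⟨m, by omega⟩) + 1 := by
        rw [(hi _).2, (hi _).2]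
      by_cases hv' : v ∈ c ⟨m, by omega⟩
      · exact ((hi _).1 _ _ hv').1
      -- On a one-dimensional flag quotient k and l act by scalars, which commute, so k * l acts
      -- there as zero.
      obtain ⟨α, hα⟩ := exists_smul_sub_mem_of_finrank_succ hle hd hv hv' ((hi _).1 k _ hv).1
      obtain ⟨β, hβ⟩ := exists_smul_sub_mem_of_finrank_succ hle hd hv hv' ((hi _).1 l _ hv).1
      have h1 := ((hi _).1 k _ hβ).1
      have h2 := ((hi _).1 l _ hα).1
      have h3 := add_mem (sub_mem h1 h2)
        (sub_mem (Submodule.smul_mem _ β hα) (Submodule.smul_mem _ α hβ))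
      convert h3 using 1
      rw [mul_mul_left]
      simp only [mul_sub, mul_smul_comm]
      module
  refine ⟨n, fun v => key n n.lt_succ_self v ?_⟩
  change v ∈ c (Fin.last n)
  simp [hn]

variable [SMulCommClass F L L]

theorem exists_iterate_mul_eq_zero_of_subalgebra [IsLeibniz L] [FiniteDimensional F L]
    {S : NonUnitalSubalgebra F L} (hS : IsSupersolvable F S) {k l : L} (hk : k ∈ S) (hl : l ∈ S) :
    ∃ n : ℕ, ∀ v ∈ S, (fun w => k * l * w)^[n] v = 0 := by
  have : FiniteDimensional F S := inferInstanceAs (FiniteDimensional F S.toSubmodule)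
  obtain ⟨n, hn⟩ := hS.exists_iterate_mul_eq_zero ⟨k, hk⟩ ⟨l, hl⟩
  refine ⟨n, fun v hv => ?_⟩
  have hcoe : ∀ (m : ℕ) (u : S), (((fun w => ⟨k, hk⟩ * ⟨l, hl⟩ * w)^[m] u : S) : L) =
      (fun w => k * l * w)^[m] (u : L) := by
    intro m
    induction m with
    | zero => intro u; rfl
    | succ m ih => intro u; rw [Function.iterate_succ_apply, Function.iterate_succ_apply, ih]; rfl
  rw [← hcoe n ⟨v, hv⟩, hn]
  rfl

variable [IsScalarTower F L L]

/-! ### Chief factors -/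

/-- A section `A / I` of ideals of `L` that is minimal and abelian, where `L / I` has no
one-dimensional ideal. -/
structure IsNonlinearChiefFactor (I A : Submodule F L) : Prop where
  isIdeal_bot : IsIdeal I
  isIdeal_top : IsIdeal A
  lt : I < A
  eq_or_eq : ∀ U, IsIdeal U → I ≤ U → U ≤ A → U = I ∨ U = A
  mem_of_isEigenMod : ∀ z, (∀ s, IsEigenMod I s z) → z ∈ I
  mul_mem : ∀ a ∈ A, ∀ b ∈ A, a * b ∈ I

/-- The Leibniz identity makes AA an ideal, so minimality leaves AA + I = I or AA + I = A;
solvability excludes the latter. -/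
theorem exists_isNonlinearChiefFactor [IsLeibniz L] [FiniteDimensional F L]
    (hsolv : IsSolvable F L) (h : ¬ IsSupersolvable F L) :
    ∃ I A : Submodule F L, IsNonlinearChiefFactor I A := by
  obtain ⟨I, hI, hIT, hz⟩ := exists_maximal_line_free_ideal h
  obtain ⟨A, ⟨hA, hIA⟩, hmin⟩ := WellFounded.has_min
    (wellFounded_lt (α := Submodule F L)) {A | IsIdeal A ∧ I < A}
    ⟨⊤, fun _ _ _ => ⟨trivial, trivial⟩, hIT.lt_top⟩
  have hmin' : ∀ U, IsIdeal U → I ≤ U → U ≤ A → U = I ∨ U = A := by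
    intro U hU hIU hUA
    by_contra! hcon
    exact hmin U ⟨hU, lt_of_le_of_ne hIU hcon.1.symm⟩ (lt_of_le_of_ne hUA hcon.2)
  refine ⟨I, A, hI, hA, hIA, hmin', hz, ?_⟩
  set P := Submodule.span F {z | ∃ x ∈ A, ∃ y ∈ A, x * y = z} with hP
  have hmem : ∀ a ∈ A, ∀ b ∈ A, a * b ∈ P := fun a ha b hb =>
    Submodule.subset_span ⟨a, ha, b, hb, rfl⟩
  have hPid : IsIdeal P := by
    intro x y hy
    induction hy using Submodule.span_induction with
    | mem y hy =>
      obtain ⟨a, ha, b, hb, rfl⟩ := hy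
      rw [IsLeibniz.leibniz x a b, mul_mul_left a b x]
      exact ⟨add_mem (hmem _ (hA x a ha).1 _ hb) (hmem _ ha _ (hA x b hb).1),
        sub_mem (hmem _ ha _ (hA x b hb).2) (hmem _ hb _ (hA x a ha).2)⟩
    | zero => simp
    | add u v _ _ hu hv =>
      rw [mul_add, add_mul]
      exact ⟨add_mem hu.1 hv.1, add_mem hu.2 hv.2⟩
    | smul r u _ hu =>
      rw [mul_smul_comm, smul_mul_assoc]
      exact ⟨P.smul_mem r hu.1, P.smul_mem r hu.2⟩
  have hPA : P ≤ A := Submodule.span_le.2 <| by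
    rintro _ ⟨x, _, y, hy, rfl⟩
    exact (hA x y hy).1
  have hPI : IsIdeal (P ⊔ I) := by
    intro x y hy
    obtain ⟨p, hp, i, hi, rfl⟩ := Submodule.mem_sup.1 hy
    rw [mul_add, add_mul]
    exact ⟨Submodule.add_mem_sup (hPid x p hp).1 (hI x i hi).1,
      Submodule.add_mem_sup (hPid x p hp).2 (hI x i hi).2⟩
  rcases hmin' _ hPI le_sup_right (sup_le hPA hIA.le) with h | h
  · exact fun a ha b hb => h ▸ Submodule.mem_sup_left (hmem a ha b hb)
  · exact absurd (le_of_le_span_mul_sup hsolv hI h.ge) (not_le_of_gt hIA)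

namespace IsNonlinearChiefFactor

variable {I A : Submodule F L}

/-- The elements al + la annihilate L from the left, so their span P is an ideal and P + I is I or
A. Either way, right multiplication on A/I is determined by left multiplication, so only left
stability needs checking afterwards. -/
theorem mul_mem_or_add_mem [IsLeibniz L] (h : IsNonlinearChiefFactor I A) :
    (∀ a ∈ A, ∀ l, a * l ∈ I) ∨ ∀ a ∈ A, ∀ l, a * l + l * a ∈ I := by
  set P := Submodule.span F {z | ∃ a ∈ A, ∃ l, a * l + l * a = z} with hP
  have hmem : ∀ a ∈ A, ∀ l, a * l + l * a ∈ P := fun a ha l =>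
    Submodule.subset_span ⟨a, ha, l, rfl⟩
  have hPx : ∀ p ∈ P, ∀ x, p * x = 0 := by
    intro p hp x
    induction hp using Submodule.span_induction with
    | mem y hy =>
      obtain ⟨a, ha, l, rfl⟩ := hy
      rw [add_mul, mul_mul_left, mul_mul_left]
      abel
    | zero => simp
    | add u v _ _ hu hv => rw [add_mul, hu, hv, add_zero]
    | smul r u _ hu => rw [smul_mul_assoc, hu, smul_zero]
  have hxP : ∀ p ∈ P, ∀ x, x * p ∈ P := by
    intro p hp x
    induction hp using Submodule.span_induction with
    | mem y hy =>
      obtain ⟨a, ha, l, rfl⟩ := hy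
      have := add_mem (hmem _ (h.isIdeal_top x a ha).1 l) (hmem _ ha (x * l))
      convert this using 1
      rw [mul_add, IsLeibniz.leibniz x a l, IsLeibniz.leibniz x l a]
      abel
    | zero => simp
    | add u v _ _ hu hv => rw [mul_add]; exact add_mem hu hv
    | smul r u _ hu => rw [mul_smul_comm]; exact P.smul_mem r hu
  have hPA : P ≤ A := Submodule.span_le.2 <| by
    rintro _ ⟨a, ha, l, rfl⟩
    exact add_mem (h.isIdeal_top l a ha).2 (h.isIdeal_top l a ha).1
  have hPI : IsIdeal (P ⊔ I) := by
    intro x y hy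
    obtain ⟨p, hp, i, hi, rfl⟩ := Submodule.mem_sup.1 hy
    rw [mul_add, add_mul, hPx p hp x, zero_add]
    exact ⟨Submodule.add_mem_sup (hxP p hp x) (h.isIdeal_bot x i hi).1,
      Submodule.mem_sup_right (h.isIdeal_bot x i hi).2⟩
  rcases h.eq_or_eq _ hPI le_sup_right (sup_le hPA h.lt.le) with h' | h'
  · exact Or.inr fun a ha l => h' ▸ Submodule.mem_sup_left (hmem a ha l)
  · left
    intro a ha l
    rw [← h'] at ha
    obtain ⟨p, hp, i, hi, rfl⟩ := Submodule.mem_sup.1 ha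
    rw [add_mul, hPx p hp l, zero_add]
    exact (h.isIdeal_bot l i hi).2

theorem eq_or_eq_of_left [IsLeibniz L] (h : IsNonlinearChiefFactor I A) {U : Submodule F L}
    (hIU : I ≤ U) (hUA : U ≤ A) (hU : ∀ l, ∀ u ∈ U, l * u ∈ U) : U = I ∨ U = A := by
  refine h.eq_or_eq U (fun x y hy => ⟨hU x y hy, ?_⟩) hIU hUA
  rcases h.mul_mem_or_add_mem with h' | h'
  · exact hIU (h' y (hUA hy) x)
  · simpa using sub_mem (hIU (h' y (hUA hy) x)) (hU x y hy)

theorem mem_of_left_eigen [IsLeibniz L] (h : IsNonlinearChiefFactor I A) {v : L} (hv : v ∈ A)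
    (hev : ∀ l, ∃ α : F, l * v - α • v ∈ I) : v ∈ I := by
  refine h.mem_of_isEigenMod v fun s => ⟨hev s, ?_⟩
  rcases h.mul_mem_or_add_mem with h' | h'
  · exact ⟨0, by simpa using h' v hv s⟩
  · obtain ⟨α, hα⟩ := hev s
    refine ⟨-α, ?_⟩
    convert sub_mem (h' v hv s) hα using 1
    module

theorem ne_top [IsLeibniz L] (h : IsNonlinearChiefFactor I A) : A ≠ ⊤ := by
  intro hA
  refine not_le_of_gt h.lt fun v hv => h.mem_of_left_eigen hv fun l => ⟨0, ?_⟩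
  simpa using h.mul_mem l (hA ▸ trivial) v hv

/-- If S were proper, a line of S stable modulo I would be stable under S + I = L. -/
theorem eq_top_of_sup_eq_top [FiniteDimensional F L] (h : IsNonlinearChiefFactor I A)
    {S : NonUnitalSubalgebra F L} (hss : S ≠ ⊤ → IsSupersolvable F S)
    (hS : ∀ l, ∃ s ∈ S, ∃ i ∈ I, s + i = l) : S = ⊤ := by
  by_contra hne
  have : ∃ w ∈ S, w ∉ I := by
    by_contra! hcon
    refine not_le_of_gt h.lt fun a _ => ?_
    obtain ⟨s, hs, i, hi, rfl⟩ := hS a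
    exact add_mem (hcon s hs) hi
  obtain ⟨w, hwS, hwI⟩ := this
  obtain ⟨z, -, -, hzI, hz⟩ := exists_isEigenMod_of_subalgebra (hss hne) (I := I) (A := ⊤)
    (fun _ _ _ => ⟨trivial, trivial⟩) hwS trivial hwI
  refine hzI (h.mem_of_isEigenMod z fun l => ?_)
  obtain ⟨s, hs, i, hi, rfl⟩ := hS l
  obtain ⟨⟨α, hα⟩, β, hβ⟩ := hz s hs
  refine ⟨⟨α, ?_⟩, β, ?_⟩
  · convert add_mem hα (h.isIdeal_bot z i hi).2 using 1
    rw [add_mul]; abel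
  · convert add_mem hβ (h.isIdeal_bot z i hi).1 using 1
    rw [mul_add]; abel

/-! ### Generating L modulo A -/

/-- If no two elements generate `L` modulo `A`, then `L` acts on `A / I` through commuting
triangularizable operators, which is impossible. -/
theorem exists_supIdeal_adjoin_eq_top [IsLeibniz L] [FiniteDimensional F L]
    (h : IsNonlinearChiefFactor I A) (hsolv : IsSolvable F L)
    (hss : ∀ S : NonUnitalSubalgebra F L, S ≠ ⊤ → IsSupersolvable F S) :
    ∃ x y : L, supIdeal (NonUnitalAlgebra.adjoin F {x, y}) A h.isIdeal_top = ⊤ := by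
  by_contra! hcon
  set P := Submodule.span F {z | ∃ x ∈ (⊤ : Submodule F L), ∃ y ∈ (⊤ : Submodule F L), x * y = z}
    with hP
  have hPA : P ⊔ A ≠ ⊤ := fun hT =>
    h.ne_top (top_le_iff.1 (le_of_le_span_mul_sup hsolv h.isIdeal_top hT.ge))
  -- A hyperplane containing LL and A; containing LL makes it a subalgebra.
  obtain ⟨K, hK, hPK⟩ := (eq_top_or_exists_le_coatom (P ⊔ A)).resolve_left hPA
  have hmulK : ∀ k l, k * l ∈ K := fun k l =>
    hPK (Submodule.mem_sup_left (Submodule.subset_span ⟨k, trivial, l, trivial, rfl⟩))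
  have hAK : A ≤ K := le_sup_right.trans hPK
  let K' : NonUnitalSubalgebra F L := { K with mul_mem' := fun _ _ => hmulK _ _ }
  have hK' : K' ≠ ⊤ := by
    intro hT
    refine hK.1 (top_le_iff.1 fun v _ => ?_)
    have : v ∈ K' := hT ▸ trivial
    exact this
  obtain ⟨w, hwA, hwI⟩ := SetLike.exists_of_lt h.lt
  obtain ⟨z, -, hzA, hzI, hz⟩ := exists_isEigenMod_of_subalgebra (hss K' hK') (I := I)
    h.isIdeal_top (hAK hwA) hwA hwI
  have hz1 : ∀ k, ∃ α : F, k ∈ K → k * z - α • z ∈ I := by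
    intro k
    by_cases hk : k ∈ K
    · obtain ⟨α, hα⟩ := (hz k hk).1
      exact ⟨α, fun _ => hα⟩
    · exact ⟨0, fun h => absurd h hk⟩
  choose χ hχ using hz1
  have hχmul : ∀ k l, χ (k * l) = 0 := by
    intro k l
    -- The algebra generated by k and l, enlarged by A, is proper, so k * l acts nilpotently on A
    -- and its eigenvalue vanishes.
    obtain ⟨n, hn⟩ := exists_iterate_mul_eq_zero_of_subalgebra (hss _ (hcon k l))
      (le_supIdeal _ _ _ (NonUnitalAlgebra.subset_adjoin F (by simp : k ∈ ({k, l} : Set L))))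
      (le_supIdeal _ _ _ (NonUnitalAlgebra.subset_adjoin F (by simp : l ∈ ({k, l} : Set L))))
    have hpow : ∀ m : ℕ, (fun w => k * l * w)^[m] z - χ (k * l) ^ m • z ∈ I := by
      intro m
      induction m with
      | zero => simp
      | succ m ih =>
        rw [Function.iterate_succ_apply']
        convert add_mem (h.isIdeal_bot (k * l) _ ih).1
          (I.smul_mem (χ (k * l) ^ m) (hχ (k * l) (hmulK k l))) using 1
        simp only [mul_sub, mul_smul_comm, pow_succ]
        module
    have h0 := hpow n
    rw [hn z (mem_supIdeal_of_mem _ _ hzA), zero_sub, neg_mem_iff] at h0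
    by_contra hne
    exact hzI ((I.smul_mem_iff (pow_ne_zero n hne)).1 h0)
  let W : Submodule F L :=
    { carrier := {v | v ∈ A ∧ ∀ k ∈ K, k * v - χ k • v ∈ I}
      zero_mem' := ⟨A.zero_mem, fun k _ => by simp⟩
      add_mem' := by
        rintro u v ⟨hu, hu'⟩ ⟨hv, hv'⟩
        refine ⟨add_mem hu hv, fun k hk => ?_⟩
        convert add_mem (hu' k hk) (hv' k hk) using 1
        rw [mul_add]; module
      smul_mem' := by
        rintro r v ⟨hv, hv'⟩
        refine ⟨A.smul_mem r hv, fun k hk => ?_⟩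
        convert I.smul_mem r (hv' k hk) using 1
        rw [mul_smul_comm]; module }
  have hIW : I ≤ W := fun i hi =>
    ⟨h.lt.le hi, fun k _ => sub_mem (h.isIdeal_bot k i hi).1 (I.smul_mem _ hi)⟩
  have hWA : W = A := by
    refine (h.eq_or_eq_of_left hIW (fun v hv => hv.1) ?_).resolve_left ?_
    -- The weight space is L-stable: k(lv) = (kl)v + l(kv), and (kl)v lies in I because χ(kl) = 0.
    · rintro l v ⟨hv, hv'⟩
      refine ⟨(h.isIdeal_top l v hv).1, fun k hk => ?_⟩
      have h1 := hv' (k * l) (hmulK k l)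
      rw [hχmul, zero_smul, sub_zero] at h1
      convert add_mem h1 (h.isIdeal_bot l _ (hv' k hk)).1 using 1
      rw [IsLeibniz.leibniz k l v, mul_sub, mul_smul_comm]
      abel
    · intro hWI
      have : z ∈ W := ⟨hzA, hχ⟩
      exact hzI (hWI ▸ this)
  obtain ⟨x, -, hxK⟩ := SetLike.exists_of_lt hK.lt_top
  -- K acts on A/I by scalars, so an eigenvector of x there is an eigenvector of K + Fx = L.
  obtain ⟨u, -, huA, huI, hu⟩ := exists_isEigenMod_of_subalgebra (hss _ (hcon x x)) (I := I)
    h.isIdeal_top (mem_supIdeal_of_mem _ _ hwA) hwA hwI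
  obtain ⟨β, hβ⟩ := (hu x (le_supIdeal _ _ _
    (NonUnitalAlgebra.subset_adjoin F (by simp : x ∈ ({x, x} : Set L))))).1
  refine huI (h.mem_of_left_eigen huA fun l => ?_)
  have hl : l ∈ K ⊔ F ∙ x := by
    rw [hK.2 (K ⊔ F ∙ x) (lt_of_le_of_ne le_sup_left fun he => hxK ?_)]
    · trivial
    · rw [he]
      exact Submodule.mem_sup_right (Submodule.mem_span_singleton_self x)
  obtain ⟨k, hk, v, hv, rfl⟩ := Submodule.mem_sup.1 hl
  obtain ⟨r, rfl⟩ := Submodule.mem_span_singleton.1 hv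
  refine ⟨χ k + r * β, ?_⟩
  have huW : u ∈ W := hWA ▸ huA
  convert add_mem (huW.2 k hk) (I.smul_mem r hβ) using 1
  rw [add_mul, smul_mul_assoc]
  module

/-- Since A acts trivially on A/I, the space (T ∩ A) + I is stable under T + A = L. By minimality it
is I or A, and A would give T + I = L. -/
theorem inf_mem_of_supIdeal_eq_top [IsLeibniz L] [FiniteDimensional F L]
    (h : IsNonlinearChiefFactor I A) {T : NonUnitalSubalgebra F L} (hT : T ≠ ⊤)
    (hss : IsSupersolvable F T) (hTA : supIdeal T A h.isIdeal_top = ⊤) {v : L}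
    (hvT : v ∈ T) (hvA : v ∈ A) : v ∈ I := by
  have hdec : ∀ l, ∃ t ∈ T, ∃ a ∈ A, t + a = l := fun l => by
    rw [← mem_supIdeal (hA := h.isIdeal_top), hTA]
    trivial
  have hleft : ∀ l, ∀ u ∈ (T.toSubmodule ⊓ A) ⊔ I, l * u ∈ (T.toSubmodule ⊓ A) ⊔ I := by
    intro l u hu
    obtain ⟨s, ⟨hsT, hsA⟩, i, hi, rfl⟩ := Submodule.mem_sup.1 hu
    obtain ⟨t, ht, a, ha, rfl⟩ := hdec l
    refine Submodule.mem_sup.2 ⟨t * s, ⟨T.mul_mem ht hsT, (h.isIdeal_top t s hsA).1⟩,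
      a * s + (t + a) * i, add_mem (h.mul_mem a ha s hsA) (h.isIdeal_bot _ _ hi).1, ?_⟩
    simp only [mul_add, add_mul]
    abel
  rcases h.eq_or_eq_of_left (U := (T.toSubmodule ⊓ A) ⊔ I) le_sup_right
    (sup_le inf_le_right h.lt.le) hleft with h' | h'
  · rw [← h']
    exact Submodule.mem_sup_left ⟨hvT, hvA⟩
  · refine absurd (h.eq_top_of_sup_eq_top (fun _ => hss) fun l => ?_) hT
    obtain ⟨t, ht, a, ha, rfl⟩ := hdec l
    rw [← h'] at ha
    obtain ⟨s, hs, i, hi, rfl⟩ := Submodule.mem_sup.1 ha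
    exact ⟨t + s, T.add_mem ht hs.1, i, hi, by abel⟩

theorem isEigenMod_add [IsLeibniz L] (h : IsNonlinearChiefFactor I A) {s a z : L} (ha : a ∈ A)
    (hs : IsEigenMod I s z) (hz : ∀ b ∈ A, z * b ∈ I) : IsEigenMod I (s + a) z := by
  obtain ⟨⟨α, hα⟩, β, hβ⟩ := hs
  have haz : a * z ∈ I := by
    rcases h.mul_mem_or_add_mem with h' | h'
    · exact h' a ha z
    · simpa using sub_mem (h' a ha z) (hz a ha)
  refine ⟨⟨α, ?_⟩, β, ?_⟩
  · convert add_mem hα haz using 1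
    rw [add_mul]; abel
  · convert add_mem hβ (hz a ha) using 1
    rw [mul_add]; abel

/-! ### Complements of A modulo I and their conjugacy -/

/-- A complement `S` of `A` modulo `I` contains an element spanning a line stable modulo `I`,
and this element acts bijectively on `A / I`. -/
theorem exists_eigen_of_complement [IsLeibniz L] [FiniteDimensional F L]
    (h : IsNonlinearChiefFactor I A) {S : NonUnitalSubalgebra F L}
    (hss : IsSupersolvable F S) (hSA : supIdeal S A h.isIdeal_top = ⊤) :
    ∃ z ∈ S, (∀ s ∈ S, IsEigenMod I s z) ∧ (∀ v ∈ A, z * v ∈ I → v ∈ I) ∧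
      (∃ v ∈ A, z * v ∉ I) ∧ ∀ v ∈ A, ∃ c ∈ A, v - z * c ∈ I := by
  have hdec : ∀ l, ∃ s ∈ S, ∃ a ∈ A, s + a = l := fun l => by
    rw [← mem_supIdeal (hA := h.isIdeal_top), hSA]
    trivial
  have hSI : ∃ w ∈ S, w ∉ I := by
    by_contra! hcon
    refine h.ne_top (top_le_iff.1 fun l _ => ?_)
    obtain ⟨s, hs, a, ha, rfl⟩ := hdec l
    exact add_mem (h.lt.le (hcon s hs)) ha
  obtain ⟨w, hwS, hwI⟩ := hSI
  obtain ⟨z, hzS, -, hzI, hz⟩ := exists_isEigenMod_of_subalgebra hss (I := I) (A := ⊤)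
    (fun _ _ _ => ⟨trivial, trivial⟩) hwS trivial hwI
  have hzA : ∃ v ∈ A, z * v ∉ I := by
    by_contra! hcon
    refine hzI (h.mem_of_isEigenMod z fun l => ?_)
    obtain ⟨s, hs, a, ha, rfl⟩ := hdec l
    exact h.isEigenMod_add ha (hz s hs) hcon
  refine ⟨z, hzS, hz, ?_, hzA, ?_⟩
  -- Schur's lemma: S sends z to multiples of z modulo I, so the kernel of z on A/I, and below its
  -- image, are L-stable.
  · let U : Submodule F L := A ⊓ I.comap (LinearMap.mulLeft F z)
    have hU : U = I := by
      refine (h.eq_or_eq_of_left (U := U)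
        (le_inf h.lt.le fun i hi => (h.isIdeal_bot z i hi).1) inf_le_left ?_).resolve_right ?_
      · rintro l v ⟨hv, hv'⟩
        replace hv' : z * v ∈ I := hv'
        refine ⟨(h.isIdeal_top l v hv).1, ?_⟩
        change z * (l * v) ∈ I
        obtain ⟨s, hs, a, ha, rfl⟩ := hdec l
        obtain ⟨β, hβ⟩ := (hz s hs).2
        have h1 := add_mem (add_mem (h.isIdeal_bot v _ hβ).2 (I.smul_mem β hv'))
          (add_mem (h.isIdeal_bot s _ hv').1
            (h.isIdeal_bot z _ (h.mul_mem a ha v hv)).1)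
        convert h1 using 1
        rw [add_mul, mul_add, IsLeibniz.leibniz z s v, sub_mul, smul_mul_assoc]
        abel
      · intro hUA
        obtain ⟨v, hv, hv'⟩ := hzA
        rw [← hUA] at hv
        exact hv' hv.2
    intro v hv hv'
    rw [← hU]
    exact ⟨hv, hv'⟩
  · let U : Submodule F L := A.map (LinearMap.mulLeft F z) ⊔ I
    have hU : U = A := by
      refine (h.eq_or_eq_of_left (U := U) le_sup_right (sup_le ?_ h.lt.le) ?_).resolve_left ?_
      · rintro _ ⟨v, hv, rfl⟩
        exact (h.isIdeal_top z v hv).1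
      · intro l u hu
        obtain ⟨_, ⟨v, hv, rfl⟩, i, hi, rfl⟩ := Submodule.mem_sup.1 hu
        obtain ⟨s, hs, a, ha, rfl⟩ := hdec l
        obtain ⟨α, hα⟩ := (hz s hs).1
        have hzv : z * v ∈ A := (h.isIdeal_top z v hv).1
        refine Submodule.mem_sup.2 ⟨z * (α • v + s * v),
          ⟨_, add_mem (A.smul_mem α hv) (h.isIdeal_top s v hv).1, rfl⟩,
          (s * z - α • z) * v + a * (z * v) + (s + a) * i,
          add_mem (add_mem (h.isIdeal_bot v _ hα).2 (h.mul_mem a ha _ hzv))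
            (h.isIdeal_bot _ i hi).1, ?_⟩
        simp only [LinearMap.mulLeft_apply, mul_add, add_mul, sub_mul, smul_mul_assoc,
          mul_smul_comm]
        rw [IsLeibniz.leibniz s z v]
        abel
      · intro hUI
        obtain ⟨v, hv, hv'⟩ := hzA
        refine hv' (hUI ▸ ?_)
        exact Submodule.mem_sup_left ⟨v, hv, rfl⟩
    intro v hv
    rw [← hU] at hv
    obtain ⟨_, ⟨c, hc, rfl⟩, i, hi, rfl⟩ := Submodule.mem_sup.1 hv
    exact ⟨c, hc, by simpa using hi⟩

/-- If two elements generate `L` modulo `A`, and no lifts of them generate `L`, then every lift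
is conjugate to the given one by an element of `A`, or congruent to it modulo `I`. -/
theorem exists_conjugating_of_adjoin_ne_top [IsLeibniz L] [FiniteDimensional F L]
    (h : IsNonlinearChiefFactor I A)
    (hss : ∀ S : NonUnitalSubalgebra F L, S ≠ ⊤ → IsSupersolvable F S)
    (hgen : ¬ IsTwoGenerated F L) {x y : L}
    (hxy : supIdeal (NonUnitalAlgebra.adjoin F {x, y}) A h.isIdeal_top = ⊤)
    {a b : L} (ha : a ∈ A) (hb : b ∈ A) :
    (a ∈ I ∧ b ∈ I) ∨ ∃ c ∈ A, a - x * c ∈ I ∧ b - y * c ∈ I := by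
  have hne : ∀ u v : L, NonUnitalAlgebra.adjoin F {u, v} ≠ ⊤ := fun u v he => hgen ⟨u, v, he⟩
  set S := NonUnitalAlgebra.adjoin F {x, y} with hS
  set T := NonUnitalAlgebra.adjoin F {x + a, y + b} with hT
  have hxS : x ∈ S := NonUnitalAlgebra.subset_adjoin F (by simp)
  have hyS : y ∈ S := NonUnitalAlgebra.subset_adjoin F (by simp)
  have hxT : x + a ∈ T := NonUnitalAlgebra.subset_adjoin F (by simp)
  have hyT : y + b ∈ T := NonUnitalAlgebra.subset_adjoin F (by simp)
  have hTA : supIdeal T A h.isIdeal_top = ⊤ := by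
    have hle : S ≤ supIdeal T A h.isIdeal_top := NonUnitalAlgebra.adjoin_le <| by
      rintro u (rfl | rfl)
      · exact mem_supIdeal.2 ⟨_, hxT, -a, neg_mem ha, by abel⟩
      · exact mem_supIdeal.2 ⟨_, hyT, -b, neg_mem hb, by abel⟩
    refine top_le_iff.1 (hxy.ge.trans fun l hl => ?_)
    obtain ⟨s, hs, v, hv, rfl⟩ := mem_supIdeal.1 hl
    exact add_mem (hle hs) (mem_supIdeal_of_mem _ _ hv)
  have hdec : ∀ l, ∃ t ∈ T, ∃ v ∈ A, t + v = l := fun l => by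
    rw [← mem_supIdeal (hA := h.isIdeal_top), hTA]
    trivial
  have hTI : ∀ v ∈ T, v ∈ A → v ∈ I := fun v hv hvA =>
    h.inf_mem_of_supIdeal_eq_top (hne _ _) (hss _ (hne _ _)) hTA hv hvA
  obtain ⟨z, hzS, hz, hzinj, ⟨w, hwA, hwI⟩, hzsurj⟩ :=
    h.exists_eigen_of_complement (hss _ (hne _ _)) hxy
  -- The lift z + d of z to T; the displacement d will determine those of x and y.
  obtain ⟨z', hz', d', hd', hzd⟩ := hdec z
  obtain ⟨d, hd, hzT⟩ : ∃ d ∈ A, z + d ∈ T :=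
    ⟨-d', neg_mem hd', by rw [← hzd]; simpa using hz'⟩
  have hpair : ∀ s ∈ S, ∃ α : F, s * z - α • z ∈ I ∧ z * s + α • z ∈ I ∧ ∀ v ∈ A, s + v ∈ T →
      s * d + v * z - α • d ∈ I ∧ z * v + d * s + α • d ∈ I := by
    intro s hs
    obtain ⟨⟨α, hα⟩, β, hβ⟩ := hz s hs
    -- (sz + zs)w = 0 gives (α + β)zw ∈ I, while zw ∉ I.
    have hαβ : β = -α := by
      have h1 := add_mem (h.isIdeal_bot w _ hα).2 (h.isIdeal_bot w _ hβ).2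
      have h2 : (-(α + β)) • (z * w) ∈ I := by
        convert h1 using 1
        rw [sub_mul, sub_mul, mul_mul_left, mul_mul_left, smul_mul_assoc, smul_mul_assoc]
        module
      by_contra hcon
      refine hwI ((I.smul_mem_iff (fun h0 => hcon ?_)).1 h2)
      linear_combination -h0
    subst hαβ
    refine ⟨α, hα, by simpa using hβ, fun v hv hsv => ⟨?_, ?_⟩⟩
    -- Modulo I, (s + v)(z + d) - α(z + d) equals this element of A; it also lies in T, hence in T ∩
    -- A ⊆ I.
    · have hA : s * d + v * z - α • d ∈ A :=
        sub_mem (add_mem (h.isIdeal_top s d hd).1 (h.isIdeal_top z v hv).2) (A.smul_mem α hd)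
      have hi := add_mem hα (h.mul_mem v hv d hd)
      have hmem := hTI _ (sub_mem (T.mul_mem hsv hzT) (T.toSubmodule.smul_mem α hzT)) (by
        convert add_mem hA (h.lt.le hi) using 1
        simp only [add_mul, mul_add, smul_add]
        abel)
      convert sub_mem hmem hi using 1
      simp only [add_mul, mul_add, smul_add]
      abel
    · have hA : z * v + d * s + α • d ∈ A :=
        add_mem (add_mem (h.isIdeal_top z v hv).1 (h.isIdeal_top s d hd).2) (A.smul_mem α hd)
      have hi := add_mem hβ (h.mul_mem d hd v hv)
      have hmem := hTI _ (add_mem (T.mul_mem hzT hsv) (T.toSubmodule.smul_mem α hzT)) (by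
        convert add_mem hA (h.lt.le hi) using 1
        simp only [add_mul, mul_add, smul_add, neg_smul]
        abel)
      convert sub_mem hmem hi using 1
      simp only [add_mul, mul_add, smul_add, neg_smul]
      abel
  rcases h.mul_mem_or_add_mem with h' | h'
  · left
    -- Here vz ∈ I, so d is an eigenvector of L modulo I.
    have hdI : d ∈ I := by
      refine h.mem_of_left_eigen hd fun l => ?_
      obtain ⟨s, hs, v, hv, rfl⟩ : ∃ s ∈ S, ∃ v ∈ A, s + v = l := by
        rw [← mem_supIdeal (hA := h.isIdeal_top), hxy]
        trivial
      obtain ⟨t, ht, u, hu, rfl⟩ := hdec s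
      obtain ⟨α, -, -, hα⟩ := hpair _ hs
      have h1 := (hα (-u) (neg_mem hu) (by simpa using ht)).1
      refine ⟨α, ?_⟩
      convert add_mem (sub_mem h1 (h' (-u) (neg_mem hu) z)) (h' v hv d) using 1
      rw [add_mul _ v]
      abel
    have key : ∀ s ∈ S, ∀ v ∈ A, s + v ∈ T → v ∈ I := by
      intro s hs v hv hsv
      obtain ⟨α, -, -, hα⟩ := hpair s hs
      refine hzinj v hv ?_
      convert sub_mem (hα v hv hsv).2 (add_mem (h.isIdeal_bot s d hdI).2 (I.smul_mem α hdI))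
        using 1
      abel
    exact ⟨key x hxS a ha hxT, key y hyS b hb hyT⟩
  · right
    -- The conjugating element solves d ≡ zc; then z(v - sc) ∈ I for each lift s + v, and z is
    -- injective on A/I.
    obtain ⟨c, hc, hdc⟩ := hzsurj d hd
    have key : ∀ s ∈ S, ∀ v ∈ A, s + v ∈ T → v - s * c ∈ I := by
      intro s hs v hv hsv
      obtain ⟨α, h0, -, hα⟩ := hpair s hs
      refine hzinj _ (sub_mem hv (h.isIdeal_top s c hc).1) ?_
      have h1 := (hα v hv hsv).2
      have h2 := h' d hd s
      have h3 := (h.isIdeal_bot s _ hdc).1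
      have h4 := (h.isIdeal_bot c _ h0).2
      have h5 := I.smul_mem α hdc
      convert add_mem (sub_mem (add_mem (sub_mem h1 h2) h3) h5) h4 using 1
      simp only [mul_sub, sub_mul, smul_sub, smul_mul_assoc]
      rw [IsLeibniz.leibniz s z c]
      abel
    exact ⟨c, hc, key x hxS a ha hxT, key y hyS b hb hyT⟩

-- Pairs (a, 0) force x to be surjective, hence injective, on A/I. For a pair (0, w) with w ∉ I, xc
-- ∈ I then gives c ∈ I and so w ∈ I. This linear form of the count is valid over finite fields too.
set_option linter.unusedSectionVars false in
theorem not_forall_exists_conjugating [FiniteDimensional F L] (h : IsNonlinearChiefFactor I A)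
    (x y : L) : ¬ ∀ a ∈ A, ∀ b ∈ A,
      (a ∈ I ∧ b ∈ I) ∨ ∃ c ∈ A, a - x * c ∈ I ∧ b - y * c ∈ I := by
  intro hall
  obtain ⟨w, hwA, hwI⟩ := SetLike.exists_of_lt h.lt
  let φ : A →ₗ[F] L ⧸ I := I.mkQ ∘ₗ LinearMap.mulLeft F x ∘ₗ A.subtype
  let ψ : A →ₗ[F] L ⧸ I := I.mkQ ∘ₗ A.subtype
  have hrange : LinearMap.range ψ ≤ LinearMap.range φ := by
    rintro _ ⟨⟨a, ha⟩, rfl⟩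
    rcases hall a ha 0 A.zero_mem with ⟨haI, -⟩ | ⟨c, hc, hac, -⟩
    · refine ⟨0, ?_⟩
      rw [map_zero]
      exact ((Submodule.Quotient.mk_eq_zero I).2 haI).symm
    · exact ⟨⟨c, hc⟩, ((Submodule.Quotient.eq I).2 hac).symm⟩
  have hker : LinearMap.ker ψ ≤ LinearMap.ker φ := by
    intro v hv
    have hv' : (v : L) ∈ I := (Submodule.Quotient.mk_eq_zero I).1 hv
    exact (Submodule.Quotient.mk_eq_zero I).2 (h.isIdeal_bot x _ hv').1
  have heq : LinearMap.ker ψ = LinearMap.ker φ := by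
    refine Submodule.eq_of_le_of_finrank_le hker ?_
    have h1 := φ.finrank_range_add_finrank_ker
    have h2 := ψ.finrank_range_add_finrank_ker
    have h3 := Submodule.finrank_mono hrange
    omega
  rcases hall 0 A.zero_mem w hwA with ⟨-, hw⟩ | ⟨c, hc, hxc, hwc⟩
  · exact hwI hw
  · have hcφ : (⟨c, hc⟩ : A) ∈ LinearMap.ker φ :=
      (Submodule.Quotient.mk_eq_zero I).2 (by simpa using hxc)
    rw [← heq] at hcφ
    have hcI : c ∈ I := (Submodule.Quotient.mk_eq_zero I).1 hcφ
    exact hwI (by simpa using add_mem hwc (h.isIdeal_bot y c hcI).1)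

end IsNonlinearChiefFactor

end

end LeibnizAlg

theorem mainTheorem9 (F : Type*) (L : Type*) [Field F] [NonUnitalNonAssocRing L] [Module F L]
    [IsScalarTower F L L] [SMulCommClass F L L] [IsLeibniz L] [FiniteDimensional F L]
    (hsolv : LeibnizAlg.IsSolvable F L)
    (hmin : LeibnizAlg.IsMinimallyNonSupersolvable F L) :
    LeibnizAlg.IsTwoGenerated F L := by
  by_contra hgen
  obtain ⟨I, A, h⟩ := LeibnizAlg.exists_isNonlinearChiefFactor hsolv hmin.1
  obtain ⟨x, y, hxy⟩ := h.exists_supIdeal_adjoin_eq_top hsolv hmin.2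
  exact h.not_forall_exists_conjugating x y fun a ha b hb =>
    h.exists_conjugating_of_adjoin_ne_top hmin.2 hgen hxy ha hb
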